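/- Let $\delta>0$ be fixed. For $0<\varepsilon\le\delta$ let $\Gamma_\varepsilon$ be the Hankel integral operator in the complex Hilbert space $L^2(\mathbb{R}_+)$, $\mathbb{R}_+=(0,\infty)$, with integral kernel $\gamma_\varepsilon(s+t)$, $s,t\in\mathbb{R}_+$, where $$\gamma_\varepsilon(t)=\int_\varepsilon^\delta e^{-t\lambda}\,d\lambda=\frac{e^{-t\varepsilon}-e^{-t\delta}}{t},\qquad t>0.$$ Then for every $0<\varepsilon\le\delta$ the operator $\Gamma_\varepsilon$ belongs to the trace class and satisfies $$\Gamma_\varepsilon\ge 0,\qquad \|\Gamma_\varepsilon\|\le\pi.$$ Moreover, for any real $q\ge 1$ (the power $(\Gamma_\varepsilon)^q$, defined by the functional calculus, is then trace class as well), one has $$\lim_{\varepsilon\to+0}|\ln\varepsilon|^{-1}\,\operatorname{tr}\,(\Gamma_\varepsilon)^q=\frac{1}{2\pi}\int_{-\infty}^{\infty}\left(\frac{\pi}{\cosh(\pi x)}\right)^q dx.$$ -/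

import Mathlib

open MeasureTheory Set
open scoped ENNReal InnerProductSpace

noncomputable section

/-! ### Trace class operators and the trace -/

/-- A bounded operator `T` on a complex Hilbert space is trace class if, for orthonormal bases
`(b i)`, the series `∑ ⟨b i, |T| b i⟩` converges, where `|T| = (T* T) ^ (1/2)`. The convergence
does not depend on the basis. -/
def IsTraceClass {H : Type*} [NormedAddCommGroup H] [InnerProductSpace ℂ H] [CompleteSpace H]
    (T : H →L[ℂ] H) : Prop :=
  ∀ (w : Set H) (b : HilbertBasis w ℂ H), Summable fun i => (⟪b i, CFC.abs T (b i)⟫_ℂ).re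

/-- Some orthonormal basis of a Hilbert space. -/
def someHilbertBasis (H : Type*) [NormedAddCommGroup H] [InnerProductSpace ℂ H]
    [CompleteSpace H] : HilbertBasis (exists_hilbertBasis ℂ H).choose ℂ H :=
  (exists_hilbertBasis ℂ H).choose_spec.choose

/-- The trace `∑ ⟨b i, T b i⟩` of a trace class operator (for such operators the value does not
depend on the orthonormal basis `(b i)`). -/
def operatorTrace {H : Type*} [NormedAddCommGroup H] [InnerProductSpace ℂ H] [CompleteSpace H]
    (T : H →L[ℂ] H) : ℂ :=
  ∑' i, ⟪someHilbertBasis H i, T (someHilbertBasis H i)⟫_ℂ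

/-- The power `T ^ q` of a positive operator, for a real exponent `q`, through the continuous
functional calculus. -/
def operatorPower {H : Type*} [NormedAddCommGroup H] [InnerProductSpace ℂ H] [CompleteSpace H]
    (T : H →L[ℂ] H) (q : ℝ) : H →L[ℂ] H :=
  T ^ q

/-! ### The Hankel operator -/

/-- Lebesgue measure on the half-line `(0, ∞)`. -/
abbrev halfLine : Measure ℝ := volume.restrict (Ioi 0)

/-- The complex Hilbert space `L²(ℝ₊)`. -/
abbrev HalfLineL2 : Type := Lp ℂ 2 halfLine

/-- The function `γ_ε(t) = (exp (-t ε) - exp (-t δ)) / t`, used for `t > 0`. -/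
def gammaKernel (ε δ t : ℝ) : ℝ := (Real.exp (-t * ε) - Real.exp (-t * δ)) / t

/-- On `ℝ₊`, `γ_ε(t) = ∫_ε^δ exp (-t l) dl`. -/
theorem gammaKernel_eq_integral (ε δ : ℝ) {t : ℝ} (ht : 0 < t) :
    gammaKernel ε δ t = ∫ l in ε..δ, Real.exp (-t * l) := by
  rw [intervalIntegral.integral_comp_mul_left (fun x => Real.exp x) (neg_ne_zero.2 ht.ne'),
    integral_exp, gammaKernel, smul_eq_mul]
  field_simp
  ring

/-- The function `t ↦ ∫_0^∞ γ_ε(s + t) f(s) ds`. -/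
def gammaIntegral (ε δ : ℝ) (f : HalfLineL2) (t : ℝ) : ℂ :=
  ∫ s, (gammaKernel ε δ (s + t) : ℂ) * f s ∂halfLine

theorem norm_gammaKernel_le {ε δ t : ℝ} (h : ε ≤ δ) (ht : 0 < t) :
    ‖gammaKernel ε δ t‖ ≤ (δ - ε) * Real.exp (-ε * t) := by
  have h1 : Real.exp (-t * δ) = Real.exp (-ε * t) * Real.exp (-(t * (δ - ε))) := by
    rw [← Real.exp_add]; ring_nf
  have h2 := Real.add_one_le_exp (-(t * (δ - ε)))
  have h3 : Real.exp (-(t * (δ - ε))) ≤ 1 :=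
    Real.exp_le_one_iff.2 (neg_nonpos.2 (mul_nonneg ht.le (sub_nonneg.2 h)))
  have h4 := Real.exp_pos (-ε * t)
  have h5 : Real.exp (-t * ε) = Real.exp (-ε * t) := by ring_nf
  rw [gammaKernel, h1, h5, Real.norm_eq_abs, abs_of_nonneg (div_nonneg (by nlinarith) ht.le),
    div_le_iff₀ ht]
  nlinarith

theorem memLp_exp_halfLine {ε : ℝ} (hε : 0 < ε) :
    MemLp (fun t : ℝ => Real.exp (-ε * t)) 2 halfLine := by
  rw [memLp_two_iff_integrable_sq (by fun_prop)]
  have h := exp_neg_integrableOn_Ioi 0 (b := 2 * ε) (by positivity)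
  refine h.congr (Filter.Eventually.of_forall fun t => ?_)
  simp only [← Real.exp_nat_mul]
  ring_nf

theorem measurable_gammaKernel (ε δ : ℝ) : Measurable (gammaKernel ε δ) := by
  unfold gammaKernel; fun_prop

theorem integrable_exp_mul_norm {ε : ℝ} (hε : 0 < ε) (f : HalfLineL2) :
    Integrable (fun s => Real.exp (-ε * s) * ‖f s‖) halfLine :=
  (memLp_exp_halfLine hε).integrable_mul (Lp.memLp f).norm

theorem norm_gammaKernel_add_mul_le {ε δ t s : ℝ} (h : ε ≤ δ) (ht : 0 < t) (hs : 0 < s) (z : ℂ) :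
    ‖(gammaKernel ε δ (s + t) : ℂ) * z‖ ≤
      (δ - ε) * Real.exp (-ε * t) * (Real.exp (-ε * s) * ‖z‖) := by
  rw [norm_mul, Complex.norm_real]
  refine (mul_le_mul_of_nonneg_right (norm_gammaKernel_le h (add_pos hs ht))
    (norm_nonneg z)).trans_eq ?_
  rw [mul_add, Real.exp_add]
  ring

theorem integrable_gammaKernel_mul {ε δ t : ℝ} (hε : 0 < ε) (h : ε ≤ δ) (ht : 0 < t)
    (f : HalfLineL2) :
    Integrable (fun s => (gammaKernel ε δ (s + t) : ℂ) * f s) halfLine := by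
  refine ((integrable_exp_mul_norm hε f).const_mul ((δ - ε) * Real.exp (-ε * t))).mono' ?_ ?_
  · refine AEStronglyMeasurable.mul ?_ (Lp.aestronglyMeasurable f)
    exact (Complex.measurable_ofReal.comp ((measurable_gammaKernel ε δ).comp
      (measurable_id.add_const t))).aestronglyMeasurable
  · filter_upwards [ae_restrict_mem measurableSet_Ioi] with s hs
    exact norm_gammaKernel_add_mul_le h ht hs _

/-- A bound for the operator norm, only used to show that the operator is bounded. -/
def gammaBound (ε δ : ℝ) : ℝ :=
  (δ - ε) * (eLpNorm (fun t : ℝ => Real.exp (-ε * t)) 2 halfLine).toReal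

theorem integral_exp_mul_norm_le {ε : ℝ} (hε : 0 < ε) (f : HalfLineL2) :
    ∫ s, Real.exp (-ε * s) * ‖f s‖ ∂halfLine ≤
      (eLpNorm (fun t : ℝ => Real.exp (-ε * t)) 2 halfLine).toReal * ‖f‖ := by
  have h1 := eLpNorm_smul_le_mul_eLpNorm (p := 2) (q := 2) (r := 1)
    (Lp.memLp f).norm.aestronglyMeasurable (memLp_exp_halfLine hε).aestronglyMeasurable
  rw [eLpNorm_norm] at h1
  have h2 : ∫ s, Real.exp (-ε * s) * ‖f s‖ ∂halfLine =
      (eLpNorm ((fun t : ℝ => Real.exp (-ε * t)) • fun s => ‖f s‖) 1 halfLine).toReal := by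
    rw [eLpNorm_one_eq_lintegral_enorm, ← integral_norm_eq_lintegral_enorm]
    · refine integral_congr_ae (Filter.Eventually.of_forall fun s => ?_)
      simp [abs_of_pos (Real.exp_pos _)]
    · exact (integrable_exp_mul_norm hε f).aestronglyMeasurable
  rw [h2, Lp.norm_def, ← ENNReal.toReal_mul]
  exact ENNReal.toReal_mono
    (ENNReal.mul_ne_top (memLp_exp_halfLine hε).eLpNorm_ne_top (Lp.eLpNorm_ne_top f)) h1

theorem norm_gammaIntegral_le {ε δ t : ℝ} (hε : 0 < ε) (h : ε ≤ δ) (ht : 0 < t)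
    (f : HalfLineL2) :
    ‖gammaIntegral ε δ f t‖ ≤ gammaBound ε δ * ‖f‖ * ‖Real.exp (-ε * t)‖ := by
  have h1 : ‖gammaIntegral ε δ f t‖ ≤
      ∫ s, (δ - ε) * Real.exp (-ε * t) * (Real.exp (-ε * s) * ‖f s‖) ∂halfLine := by
    refine norm_integral_le_of_norm_le
      ((integrable_exp_mul_norm hε f).const_mul ((δ - ε) * Real.exp (-ε * t))) ?_
    filter_upwards [ae_restrict_mem measurableSet_Ioi] with s hs
    exact norm_gammaKernel_add_mul_le h ht hs _
  rw [integral_const_mul] at h1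
  refine h1.trans ((mul_le_mul_of_nonneg_left (integral_exp_mul_norm_le hε f)
    (mul_nonneg (sub_nonneg.2 h) (Real.exp_pos _).le)).trans_eq ?_)
  rw [Real.norm_of_nonneg (Real.exp_pos _).le, gammaBound]
  ring

theorem aestronglyMeasurable_gammaIntegral (ε δ : ℝ) (f : HalfLineL2) :
    AEStronglyMeasurable (gammaIntegral ε δ f) halfLine := by
  refine AEStronglyMeasurable.integral_prod_right'
    (f := fun p : ℝ × ℝ => (gammaKernel ε δ (p.2 + p.1) : ℂ) * f p.2) ?_
  refine AEStronglyMeasurable.mul ?_ (Lp.aestronglyMeasurable f).comp_snd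
  exact (Complex.measurable_ofReal.comp ((measurable_gammaKernel ε δ).comp
    (measurable_snd.add measurable_fst))).aestronglyMeasurable

theorem ae_norm_gammaIntegral_le {ε δ : ℝ} (hε : 0 < ε) (h : ε ≤ δ) (f : HalfLineL2) :
    ∀ᵐ t ∂halfLine,
      ‖gammaIntegral ε δ f t‖ ≤ gammaBound ε δ * ‖f‖ * ‖Real.exp (-ε * t)‖ := by
  filter_upwards [ae_restrict_mem measurableSet_Ioi] with t ht
  exact norm_gammaIntegral_le hε h ht f

theorem memLp_gammaIntegral {ε δ : ℝ} (hε : 0 < ε) (h : ε ≤ δ) (f : HalfLineL2) :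
    MemLp (gammaIntegral ε δ f) 2 halfLine :=
  (memLp_exp_halfLine hε).of_le_mul (aestronglyMeasurable_gammaIntegral ε δ f)
    (ae_norm_gammaIntegral_le hε h f)

/-- The linear map `f ↦ ∫_0^∞ γ_ε(s + ·) f(s) ds` in `L²(ℝ₊)`. -/
def gammaLinearMap {ε δ : ℝ} (hε : 0 < ε) (h : ε ≤ δ) : HalfLineL2 →ₗ[ℂ] HalfLineL2 where
  toFun f := (memLp_gammaIntegral hε h f).toLp
  map_add' f g := by
    rw [← MemLp.toLp_add, MemLp.toLp_eq_toLp_iff]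
    filter_upwards [ae_restrict_mem measurableSet_Ioi] with t ht
    rw [Pi.add_apply, gammaIntegral, gammaIntegral, gammaIntegral,
      ← integral_add (integrable_gammaKernel_mul hε h ht f) (integrable_gammaKernel_mul hε h ht g)]
    refine integral_congr_ae ?_
    filter_upwards [Lp.coeFn_add f g] with s hs
    rw [hs, Pi.add_apply, mul_add]
  map_smul' c f := by
    rw [RingHom.id_apply, ← MemLp.toLp_const_smul, MemLp.toLp_eq_toLp_iff]
    refine Filter.Eventually.of_forall fun t => ?_
    rw [Pi.smul_apply, gammaIntegral, gammaIntegral, smul_eq_mul, ← integral_const_mul]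
    refine integral_congr_ae ?_
    filter_upwards [Lp.coeFn_smul c f] with s hs
    rw [hs, Pi.smul_apply, smul_eq_mul]
    ring

theorem norm_gammaLinearMap_le {ε δ : ℝ} (hε : 0 < ε) (h : ε ≤ δ) (f : HalfLineL2) :
    ‖gammaLinearMap hε h f‖ ≤
      gammaBound ε δ * (eLpNorm (fun t : ℝ => Real.exp (-ε * t)) 2 halfLine).toReal * ‖f‖ := by
  have h0 : 0 ≤ gammaBound ε δ * ‖f‖ :=
    mul_nonneg (mul_nonneg (sub_nonneg.2 h) ENNReal.toReal_nonneg) (norm_nonneg f)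
  have h1 := eLpNorm_le_mul_eLpNorm_of_ae_le_mul (ae_norm_gammaIntegral_le hε h f) 2
  have h2 := ENNReal.toReal_mono
    (ENNReal.mul_ne_top ENNReal.ofReal_ne_top (memLp_exp_halfLine hε).eLpNorm_ne_top) h1
  rw [ENNReal.toReal_mul, ENNReal.toReal_ofReal h0] at h2
  change ‖(memLp_gammaIntegral hε h f).toLp‖ ≤ _
  rw [Lp.norm_toLp]
  exact h2.trans_eq (by ring)

/-- The Hankel operator `Γ_ε` in `L²(ℝ₊)` with integral kernel `γ_ε(s + t)`, for `0 < ε ≤ δ`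
(and the zero operator for other values of the parameters, which are never used). -/
def Gamma (ε δ : ℝ) : HalfLineL2 →L[ℂ] HalfLineL2 :=
  if h : 0 < ε ∧ ε ≤ δ then
    (gammaLinearMap h.1 h.2).mkContinuous _ (norm_gammaLinearMap_le h.1 h.2)
  else 0

/-- `Γ_ε` is the integral operator with kernel `γ_ε(s + t)`. -/
theorem Gamma_apply_ae {ε δ : ℝ} (hε : 0 < ε) (h : ε ≤ δ) (f : HalfLineL2) :
    Gamma ε δ f =ᵐ[halfLine] fun t => ∫ s in Ioi 0, (gammaKernel ε δ (s + t) : ℂ) * f s := by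
  rw [Gamma, dif_pos ⟨hε, h⟩]
  exact (memLp_gammaIntegral hε h f).coeFn_toLp

end

open Filter Topology

/-! Substituting `λ = exp x` in the kernel writes `Γ_ε` as the integral over `[log ε, log δ]` of the
rank one operators `⟨v x, ·⟩ v x`, where `v x` is the exponential `exp (-λ t)` times `λ ^ (1/2)`
(`isRankOneIntegral_Gamma`). Positivity is then immediate. The vectors satisfy `⟪v x, v y⟫ = k (x -
y)` with `k = sechKernel` (`inner_expVec_expVec`), so up to zero eigenvalues `Γ_ε` is convolution
with `k` truncated to an interval of length `log δ - log ε`. The Fourier transform of `k` is `σ ξ =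
π / cosh (π ξ)`, with maximum `π`, and the limit is a Szegő type theorem for growing intervals.

Parseval gives `tr (T g(T)) = ∫ ⟪v x, g(T) v x⟫ dx`, with `g t = t ^ (q - 1)` for the power `q`;
this also yields the trace class property. For `g t = t ^ n` the integrand is the diagonal of an
iterated truncated kernel. Its average over the interval tends to the convolution power of `k` at
zero, that is `(2π)⁻¹ ∫ σ ^ (n + 1)` (`tendsto_integral_truncKernel_diag`). Weierstrass
approximation on `[0, π]`, which contains the spectrum by `IsRankOneIntegral.norm_le_pi`, extends
this to continuous `g`. The error is uniform in the interval because `‖v x‖ ^ 2 = 1 / 2`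
(`tendsto_mean_inner_cfc`). -/

/-! ### The kernel `k` and its Fourier transform. -/

/-- The kernel `1 / (2 cosh (x / 2))` of the Carleman operator in logarithmic coordinates. -/
noncomputable def sechKernel (x : ℝ) : ℝ := 1 / (2 * Real.cosh (x / 2))

theorem sechKernel_pos (x : ℝ) : 0 < sechKernel x := by
  have := Real.cosh_pos (x / 2)
  unfold sechKernel; positivity

theorem sechKernel_zero : sechKernel 0 = 1 / 2 := by simp [sechKernel]

theorem sechKernel_le (x : ℝ) : sechKernel x ≤ 1 / 2 := by
  unfold sechKernel
  have := Real.one_le_cosh (x / 2)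
  gcongr
  linarith

theorem continuous_sechKernel : Continuous sechKernel := by
  unfold sechKernel
  refine continuous_const.div (by fun_prop) fun x => ?_
  have := Real.cosh_pos (x / 2)
  positivity

theorem sechKernel_eq_exp (x : ℝ) : sechKernel x = Real.exp (x / 2) / (1 + Real.exp x) := by
  have h : Real.exp x = Real.exp (x / 2) * Real.exp (x / 2) := by
    rw [← Real.exp_add]; ring_nf
  have h2 := Real.exp_pos (x / 2)
  rw [sechKernel, Real.cosh_eq, h, Real.exp_neg]
  field_simp
  ring

/-- With `s = sigmoid z` the Jacobian `s (1 - s)` absorbs both exponents `-1`. Since `s / (1 - s) =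
exp z`, the oscillating factor is `exp (i z ξ)`, and what remains is `(s (1 - s)) ^ (1/2) = k z`. -/
theorem abs_deriv_smul_beta_integrand (ξ z : ℝ) :
    |Real.sigmoid z * (1 - Real.sigmoid z)| •
      ((Real.sigmoid z : ℂ) ^ ((1 / 2 + ξ * Complex.I) - 1) *
        (1 - (Real.sigmoid z : ℂ)) ^ ((1 / 2 - ξ * Complex.I) - 1)) =
      (sechKernel z : ℂ) * Complex.exp (z * ξ * Complex.I) := by
  have hs : 0 < Real.sigmoid z := Real.sigmoid_pos z
  have hs1 : 0 < 1 - Real.sigmoid z := sub_pos.2 (Real.sigmoid_lt_one z)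
  set s := Real.sigmoid z with hsdef
  have h1 : 1 - s = 1 / (1 + Real.exp z) := by
    rw [hsdef, Real.sigmoid_def, Real.exp_neg]
    have := Real.exp_pos z
    field_simp
    ring
  have h2 : s = Real.exp z * (1 - s) := by
    rw [h1, hsdef, Real.sigmoid_def, Real.exp_neg]
    have := Real.exp_pos z
    field_simp
    ring
  have hlog : Real.log s = z + Real.log (1 - s) := by
    conv_lhs => rw [h2, Real.log_mul (Real.exp_pos z).ne' hs1.ne', Real.log_exp]
  set l := Real.log (1 - s) with hl
  have e1 : (s : ℂ) = Complex.exp (z + l : ℝ) := by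
    rw [← hlog, ← Complex.ofReal_exp, Real.exp_log hs]
  have e2 : (1 - (s : ℂ)) = Complex.exp l := by
    rw [← Complex.ofReal_exp, hl, Real.exp_log hs1]; push_cast; rfl
  have c1 : (s : ℂ) ^ ((1 / 2 + ξ * Complex.I) - 1) =
      Complex.exp ((z + l : ℝ) * ((1 / 2 + ξ * Complex.I) - 1)) := by
    rw [Complex.cpow_def_of_ne_zero (by exact_mod_cast hs.ne'), ← Complex.ofReal_log hs.le, hlog]
  have c2 : (1 - (s : ℂ)) ^ ((1 / 2 - ξ * Complex.I) - 1) =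
      Complex.exp (l * ((1 / 2 - ξ * Complex.I) - 1)) := by
    have : (1 - (s : ℂ)) = ((1 - s : ℝ) : ℂ) := by push_cast; rfl
    rw [this, Complex.cpow_def_of_ne_zero (by exact_mod_cast hs1.ne'), ← Complex.ofReal_log hs1.le]
  have hk : (sechKernel z : ℂ) = Complex.exp (z / 2) * Complex.exp l := by
    rw [← e2, sechKernel_eq_exp, div_eq_mul_one_div, ← h1]
    push_cast; rfl
  rw [abs_of_pos (mul_pos hs hs1), Complex.real_smul, c1, c2, hk]
  push_cast
  rw [e2, e1]
  simp only [← Complex.exp_add]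
  congr 1
  push_cast
  ring

theorem range_sigmoid_eq : Real.sigmoid '' univ = Ioo 0 1 := by
  rw [image_univ, Real.range_sigmoid]

theorem hasDerivWithinAt_sigmoid (x : ℝ) : HasDerivWithinAt Real.sigmoid
    (Real.sigmoid x * (1 - Real.sigmoid x)) univ x :=
  (Real.hasDerivAt_sigmoid x).hasDerivWithinAt

/-- The sigmoid substitution turns the left side into the beta integral `B(1/2 + iξ, 1/2 - iξ)`. The
arguments sum to `1`, so the reflection formula evaluates it as `π / sin (π (1/2 + iξ))`. -/
theorem integral_sechKernel_mul_exp (ξ : ℝ) :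
    ∫ z : ℝ, (sechKernel z : ℂ) * Complex.exp (z * ξ * Complex.I) =
      ((Real.pi / Real.cosh (Real.pi * ξ) : ℝ) : ℂ) := by
  have h := integral_image_eq_integral_abs_deriv_smul MeasurableSet.univ
    (fun x _ => hasDerivWithinAt_sigmoid x) Real.sigmoid_injective.injOn
    (fun x : ℝ => (x : ℂ) ^ ((1 / 2 + ξ * Complex.I) - 1) *
        (1 - (x : ℂ)) ^ ((1 / 2 - ξ * Complex.I) - 1))
  simp only [abs_deriv_smul_beta_integrand] at h
  rw [setIntegral_univ, range_sigmoid_eq, ← integral_Ioc_eq_integral_Ioo,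
    ← intervalIntegral.integral_of_le zero_le_one] at h
  have hb : ∫ x in (0 : ℝ)..1, (x : ℂ) ^ ((1 / 2 + ξ * Complex.I) - 1) *
        (1 - (x : ℂ)) ^ ((1 / 2 - ξ * Complex.I) - 1) =
      Complex.betaIntegral (1 / 2 + ξ * Complex.I) (1 / 2 - ξ * Complex.I) := rfl
  have hg := Complex.Gamma_mul_Gamma_eq_betaIntegral (s := 1 / 2 + ξ * Complex.I)
    (t := 1 / 2 - ξ * Complex.I) (by simp) (by simp)
  have hr := Complex.Gamma_mul_Gamma_one_sub (1 / 2 + ξ * Complex.I)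
  have e1 : (1 : ℂ) - (1 / 2 + ξ * Complex.I) = 1 / 2 - ξ * Complex.I := by ring
  have e2 : (1 / 2 + ξ * Complex.I) + (1 / 2 - ξ * Complex.I) = 1 := by ring
  rw [e2, Complex.Gamma_one, one_mul] at hg
  rw [e1, hg] at hr
  rw [← h, hb, hr]
  have : (Real.pi : ℂ) * (1 / 2 + ξ * Complex.I) =
      (Real.pi * ξ : ℝ) * Complex.I + Real.pi / 2 := by push_cast; ring
  rw [this, Complex.sin_add_pi_div_two, Complex.cos_mul_I]
  push_cast
  rfl

theorem integrable_sechKernel : Integrable sechKernel := by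
  have h := integrableOn_image_iff_integrableOn_abs_deriv_smul MeasurableSet.univ
    (fun x _ => hasDerivWithinAt_sigmoid x) Real.sigmoid_injective.injOn
    (fun x : ℝ => (x : ℂ) ^ ((1 / 2 + (0 : ℝ) * Complex.I) - 1) *
        (1 - (x : ℂ)) ^ ((1 / 2 - (0 : ℝ) * Complex.I) - 1))
  simp only [abs_deriv_smul_beta_integrand] at h
  rw [integrableOn_univ, range_sigmoid_eq, ← integrableOn_Ioc_iff_integrableOn_Ioo,
    ← intervalIntegrable_iff_integrableOn_Ioc_of_le zero_le_one] at h
  have h2 := h.1 (Complex.betaIntegral_convergent (u := 1 / 2 + (0 : ℝ) * Complex.I)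
    (v := 1 / 2 - (0 : ℝ) * Complex.I) (by simp) (by simp))
  simpa using h2.re

theorem integral_sechKernel : ∫ z : ℝ, sechKernel z = Real.pi := by
  have h := integral_sechKernel_mul_exp 0
  simp only [Complex.ofReal_zero, mul_zero, zero_mul, Complex.exp_zero, mul_one, Real.cosh_zero,
    div_one] at h
  rw [integral_complex_ofReal] at h
  exact_mod_cast h

/-- The symbol `π / cosh (π ξ)` of the Carleman operator. -/
noncomputable def sechSymbol (ξ : ℝ) : ℝ := Real.pi / Real.cosh (Real.pi * ξ)

theorem sechSymbol_eq (ξ : ℝ) : sechSymbol ξ = 2 * Real.pi * sechKernel (2 * Real.pi * ξ) := by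
  have := (Real.cosh_pos (Real.pi * ξ)).ne'
  rw [sechSymbol, sechKernel, show 2 * Real.pi * ξ / 2 = Real.pi * ξ by ring]
  field_simp

theorem sechSymbol_pos (ξ : ℝ) : 0 < sechSymbol ξ :=
  div_pos Real.pi_pos (Real.cosh_pos _)

theorem sechSymbol_le (ξ : ℝ) : sechSymbol ξ ≤ Real.pi :=
  div_le_self Real.pi_pos.le (Real.one_le_cosh _)

theorem continuous_sechSymbol : Continuous sechSymbol :=
  continuous_const.div (by fun_prop) fun x => (Real.cosh_pos _).ne'

theorem integrable_sechSymbol : Integrable sechSymbol := by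
  have h := (integrable_sechKernel.comp_mul_left' (R := 2 * Real.pi) (by positivity)).const_mul
    (2 * Real.pi)
  exact h.congr (Filter.Eventually.of_forall fun ξ => (sechSymbol_eq ξ).symm)

/-- The symbol is a rescaled copy of `k`, so this inverse transform follows from the forward formula
by scaling, without Fourier inversion. -/
theorem integral_sechSymbol_mul_exp (x : ℝ) :
    1 / (2 * Real.pi) * ∫ ξ : ℝ, (sechSymbol ξ : ℂ) * Complex.exp (x * ξ * Complex.I) =
      sechKernel x := by
  have h := integral_sechKernel_mul_exp (x / (2 * Real.pi))
  have h2 := Measure.integral_comp_mul_left (fun z : ℝ => (sechKernel z : ℂ) *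
    Complex.exp (z * (x / (2 * Real.pi) : ℝ) * Complex.I)) (2 * Real.pi)
  have hp : (Real.pi : ℂ) ≠ 0 := by exact_mod_cast Real.pi_ne_zero
  have h3 : ∀ ξ : ℝ, (sechSymbol ξ : ℂ) * Complex.exp (x * ξ * Complex.I) =
      2 * Real.pi * ((sechKernel (2 * Real.pi * ξ) : ℂ) *
        Complex.exp ((2 * Real.pi * ξ : ℝ) * (x / (2 * Real.pi) : ℝ) * Complex.I)) := by
    intro ξ
    rw [sechSymbol_eq]
    push_cast
    have : (2 * Real.pi * ξ : ℂ) * (x / (2 * Real.pi)) * Complex.I = x * ξ * Complex.I := by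
      field_simp
    rw [this]; ring
  simp_rw [h3]
  rw [integral_const_mul, h2, h, abs_of_pos (by positivity), Complex.real_smul]
  have h4 : Real.pi / Real.cosh (Real.pi * (x / (2 * Real.pi))) = 2 * Real.pi * sechKernel x := by
    have := (Real.cosh_pos (x / 2)).ne'
    rw [sechKernel, show Real.pi * (x / (2 * Real.pi)) = x / 2 by field_simp]
    field_simp
  rw [h4]
  push_cast
  field_simp

/-! ### Iterated truncated kernels and their limits. -/

/-- The iterated kernels of the convolution operator with kernel `sechKernel`, truncated to the
interval `[a, b]`. -/
noncomputable def truncKernel (a b : ℝ) : ℕ → ℝ → ℝ → ℂ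
  | 0 => fun x y => sechKernel (x - y)
  | n + 1 => fun x y => ∫ z in a..b, (sechKernel (x - z) : ℂ) * truncKernel a b n z y

theorem truncKernel_succ (a b : ℝ) (n : ℕ) (x y : ℝ) : truncKernel a b (n + 1) x y =
    ∫ z in a..b, (sechKernel (x - z) : ℂ) * truncKernel a b n z y := rfl

theorem continuous_truncKernel (a b : ℝ) (n : ℕ) :
    Continuous fun p : ℝ × ℝ => truncKernel a b n p.1 p.2 := by
  induction n with
  | zero =>
    exact Complex.continuous_ofReal.comp (continuous_sechKernel.comp (by fun_prop))
  | succ n ih =>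
    refine intervalIntegral.continuous_parametric_intervalIntegral_of_continuous'
      (f := fun (p : ℝ × ℝ) z => (sechKernel (p.1 - z) : ℂ) * truncKernel a b n z p.2) ?_ a b
    refine (Complex.continuous_ofReal.comp (continuous_sechKernel.comp (by fun_prop))).mul ?_
    exact ih.comp (g := fun p : ℝ × ℝ => truncKernel a b n p.1 p.2)
      (f := fun q : (ℝ × ℝ) × ℝ => (q.2, q.1.2)) (by fun_prop)

theorem integrable_sechKernel_sub (x : ℝ) : Integrable fun z => sechKernel (x - z) :=
  integrable_sechKernel.comp_sub_left x

theorem integral_sechKernel_sub (x : ℝ) : ∫ z, sechKernel (x - z) = Real.pi := by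
  rw [integral_sub_left_eq_self sechKernel volume x, integral_sechKernel]

/-- One factor is bounded by its supremum `1 / 2`; every integration costs at most the total mass
`π` of `k`. The bound is independent of the interval, as dominated convergence requires below. -/
theorem norm_truncKernel_le {a b : ℝ} (h : a ≤ b) (n : ℕ) (x y : ℝ) :
    ‖truncKernel a b n x y‖ ≤ Real.pi ^ n / 2 := by
  induction n generalizing x with
  | zero =>
    rw [truncKernel, Complex.norm_real, Real.norm_of_nonneg (sechKernel_pos _).le]
    simpa using sechKernel_le (x - y)
  | succ n ih =>
    have hp : 0 ≤ Real.pi ^ n / 2 := by positivity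
    have h1 : ‖truncKernel a b (n + 1) x y‖ ≤
        ∫ z in a..b, sechKernel (x - z) * (Real.pi ^ n / 2) := by
      refine intervalIntegral.norm_integral_le_of_norm_le h ?_
        ((integrable_sechKernel_sub x).mul_const _).intervalIntegrable
      refine Eventually.of_forall fun z _ => ?_
      rw [norm_mul, Complex.norm_real, Real.norm_of_nonneg (sechKernel_pos _).le]
      exact mul_le_mul_of_nonneg_left (ih z) (sechKernel_pos _).le
    refine h1.trans ?_
    rw [intervalIntegral.integral_mul_const, intervalIntegral.integral_of_le h, pow_succ,
      mul_comm (Real.pi ^ n), mul_div_assoc]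
    refine mul_le_mul_of_nonneg_right ?_ hp
    refine (setIntegral_le_integral (integrable_sechKernel_sub x)
      (Eventually.of_forall fun z => (sechKernel_pos _).le)).trans_eq (integral_sechKernel_sub x)

theorem truncKernel_add_add (a b : ℝ) (n : ℕ) (x y h : ℝ) :
    truncKernel a b n (x + h) (y + h) = truncKernel (a - h) (b - h) n x y := by
  induction n generalizing x with
  | zero => simp [truncKernel]
  | succ n ih =>
    rw [truncKernel_succ, truncKernel_succ]
    have := intervalIntegral.integral_comp_add_right (a := a - h) (b := b - h)
      (fun z => (sechKernel (x + h - z) : ℂ) * truncKernel a b n z (y + h)) h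
    rw [sub_add_cancel, sub_add_cancel] at this
    rw [← this]
    refine intervalIntegral.integral_congr fun z _ => ?_
    simp only [ih, add_sub_add_right_eq_sub]

/-- The convolution powers of `sechKernel` on the real line. -/
noncomputable def convKernel (n : ℕ) (x : ℝ) : ℂ :=
  1 / (2 * Real.pi) * ∫ ξ : ℝ, (sechSymbol ξ : ℂ) ^ (n + 1) * Complex.exp (x * ξ * Complex.I)

theorem norm_exp_mul_mul_I (x ξ : ℝ) : ‖Complex.exp (x * ξ * Complex.I)‖ = 1 := by
  rw [← Complex.ofReal_mul, Complex.norm_exp_ofReal_mul_I]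

theorem norm_sechSymbol_pow_le (n : ℕ) (ξ : ℝ) :
    ‖(sechSymbol ξ : ℂ) ^ (n + 1)‖ ≤ Real.pi ^ n * sechSymbol ξ := by
  have h := sechSymbol_pos ξ
  rw [norm_pow, Complex.norm_real, Real.norm_of_nonneg h.le, pow_succ]
  gcongr
  exact sechSymbol_le ξ

theorem continuous_sechSymbol_pow (n : ℕ) : Continuous fun ξ => (sechSymbol ξ : ℂ) ^ n :=
  (Complex.continuous_ofReal.comp continuous_sechSymbol).pow n

theorem integrable_sechSymbol_pow (n : ℕ) : Integrable fun ξ => (sechSymbol ξ : ℂ) ^ (n + 1) :=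
  (integrable_sechSymbol.const_mul (Real.pi ^ n)).mono'
    (continuous_sechSymbol_pow _).aestronglyMeasurable
    (Eventually.of_forall (norm_sechSymbol_pow_le n))

/-- After Fubini, the inner integral over `z` is the Fourier transform of `k` at `-ξ`, an even
function, which supplies one more factor `σ ξ`. -/
theorem integral_sechKernel_mul_convKernel (n : ℕ) (x : ℝ) :
    ∫ z, (sechKernel (x - z) : ℂ) * convKernel n z = convKernel (n + 1) x := by
  have h1 : ∀ z, (sechKernel (x - z) : ℂ) * convKernel n z = 1 / (2 * Real.pi) *
      ∫ ξ, (sechKernel (x - z) : ℂ) *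
        ((sechSymbol ξ : ℂ) ^ (n + 1) * Complex.exp (z * ξ * Complex.I)) := by
    intro z
    rw [integral_const_mul, convKernel]
    ring
  simp_rw [h1]
  rw [integral_const_mul, convKernel, integral_integral_swap]
  · congr 1
    refine integral_congr_ae (Eventually.of_forall fun ξ => ?_)
    have h2 := integral_sub_left_eq_self (fun z : ℝ => (sechKernel z : ℂ) *
      ((sechSymbol ξ : ℂ) ^ (n + 1) * Complex.exp ((x - z : ℝ) * ξ * Complex.I))) volume x
    simp only [sub_sub_cancel] at h2
    simp only
    rw [h2]
    have h3 : ∀ z : ℝ, (sechKernel z : ℂ) *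
        ((sechSymbol ξ : ℂ) ^ (n + 1) * Complex.exp ((x - z : ℝ) * ξ * Complex.I)) =
        (sechSymbol ξ : ℂ) ^ (n + 1) * Complex.exp (x * ξ * Complex.I) *
        ((sechKernel z : ℂ) * Complex.exp (z * (-ξ : ℝ) * Complex.I)) := by
      intro z
      have : ((x - z : ℝ) * ξ * Complex.I : ℂ) =
          x * ξ * Complex.I + z * (-ξ : ℝ) * Complex.I := by push_cast; ring
      rw [this, Complex.exp_add]
      ring
    simp_rw [h3]
    rw [integral_const_mul, integral_sechKernel_mul_exp, mul_neg, Real.cosh_neg, pow_succ _ (n + 1)]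
    change _ * ((sechSymbol ξ : ℝ) : ℂ) = _
    ring
  · have h4 : Integrable (fun p : ℝ × ℝ =>
        (sechKernel (x - p.1) : ℂ) * (sechSymbol p.2 : ℂ) ^ (n + 1)) (volume.prod volume) :=
      (integrable_sechKernel_sub x).ofReal.mul_prod (integrable_sechSymbol_pow n)
    refine h4.mono ?_ (Eventually.of_forall fun p => ?_)
    · refine Continuous.aestronglyMeasurable ?_
      refine (Complex.continuous_ofReal.comp (continuous_sechKernel.comp (by fun_prop))).mul ?_
      exact ((continuous_sechSymbol_pow (n + 1)).comp continuous_snd).mul (by fun_prop)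
    · simp only [Function.uncurry, norm_mul, norm_exp_mul_mul_I, mul_one, le_refl]

/-- Dominated convergence at each iteration, with majorant a multiple of `k (x - z)`. The product
filter lets the two ends of the interval escape independently. -/
theorem tendsto_truncKernel (n : ℕ) (x : ℝ) :
    Tendsto (fun p : ℝ × ℝ => truncKernel p.1 p.2 n x 0) (atBot ×ˢ atTop)
      (𝓝 (convKernel n x)) := by
  induction n generalizing x with
  | zero =>
    have h := integral_sechSymbol_mul_exp x
    have : convKernel 0 x = sechKernel x := by
      rw [← h, convKernel]; simp
    rw [this]
    simp [truncKernel]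
  | succ n ih =>
    have hle : ∀ᶠ p : ℝ × ℝ in atBot ×ˢ atTop, p.1 ≤ p.2 := by
      filter_upwards [(eventually_le_atBot (0 : ℝ)).prod_mk (eventually_ge_atTop (0 : ℝ))] with p hp
      exact hp.1.trans hp.2
    rw [← integral_sechKernel_mul_convKernel]
    have key : Tendsto (fun p : ℝ × ℝ => ∫ z, (Ioc p.1 p.2).indicator
        (fun z => (sechKernel (x - z) : ℂ) * truncKernel p.1 p.2 n z 0) z) (atBot ×ˢ atTop)
        (𝓝 (∫ z, (sechKernel (x - z) : ℂ) * convKernel n z)) := by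
      refine tendsto_integral_filter_of_dominated_convergence
        (fun z => sechKernel (x - z) * (Real.pi ^ n / 2)) ?_ ?_
        ((integrable_sechKernel_sub x).mul_const _) ?_
      · refine Eventually.of_forall fun p => ?_
        refine AEStronglyMeasurable.indicator ?_ measurableSet_Ioc
        refine Continuous.aestronglyMeasurable ?_
        refine (Complex.continuous_ofReal.comp (continuous_sechKernel.comp (by fun_prop))).mul ?_
        exact (continuous_truncKernel p.1 p.2 n).comp
          (f := fun z : ℝ => (z, (0 : ℝ))) (by fun_prop)
      · filter_upwards [hle] with p hp
        refine Eventually.of_forall fun z => ?_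
        refine (norm_indicator_le_norm_self _ _).trans ?_
        rw [norm_mul, Complex.norm_real, Real.norm_of_nonneg (sechKernel_pos _).le]
        exact mul_le_mul_of_nonneg_left (norm_truncKernel_le hp n z 0) (sechKernel_pos _).le
      · refine Eventually.of_forall fun z => ?_
        refine ((ih z).const_mul (sechKernel (x - z) : ℂ)).congr' ?_
        filter_upwards [(eventually_lt_atBot z).prod_mk (eventually_ge_atTop z)] with p hp
        rw [indicator_of_mem (show z ∈ Ioc p.1 p.2 from ⟨hp.1, hp.2⟩)]
    refine key.congr' ?_
    filter_upwards [hle] with p hp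
    rw [integral_indicator measurableSet_Ioc, truncKernel_succ, intervalIntegral.integral_of_le hp]

/-- Put `x = a + (b - a) θ` and translate this point to the origin: the interval becomes `[-θ (b -
a), (1 - θ) (b - a)]`, which exhausts the line for `0 < θ < 1`. -/
theorem tendsto_integral_truncKernel_diag (b : ℝ) (n : ℕ) :
    Tendsto (fun a : ℝ => ((b - a : ℝ) : ℂ)⁻¹ * ∫ x in a..b, truncKernel a b n x x) atBot
      (𝓝 (convKernel n 0)) := by
  have hlen : Tendsto (fun a : ℝ => b - a) atBot atTop :=
    tendsto_const_nhds.add_atTop tendsto_neg_atBot_atTop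
  have key : Tendsto (fun a : ℝ => ∫ θ in (0 : ℝ)..1,
      truncKernel a b n (a + (b - a) * θ) (a + (b - a) * θ)) atBot
      (𝓝 (∫ θ in (0 : ℝ)..1, convKernel n 0)) := by
    refine intervalIntegral.tendsto_integral_filter_of_dominated_convergence
      (fun _ => Real.pi ^ n / 2) ?_ ?_ intervalIntegrable_const ?_
    · refine Eventually.of_forall fun a => Continuous.aestronglyMeasurable ?_
      exact (continuous_truncKernel a b n).comp
        (f := fun θ : ℝ => (a + (b - a) * θ, a + (b - a) * θ)) (by fun_prop)
    · filter_upwards [eventually_le_atBot b] with a ha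
      exact Eventually.of_forall fun θ _ => norm_truncKernel_le ha n _ _
    · have h1 : ∀ᵐ θ : ℝ, θ ≠ 1 := by
        simp [ae_iff]
      filter_upwards [h1] with θ hθ hmem
      rw [uIoc_of_le zero_le_one] at hmem
      have hθ1 : 0 < 1 - θ := sub_pos.2 (lt_of_le_of_ne hmem.2 hθ)
      have l1 : Tendsto (fun a : ℝ => -(θ * (b - a))) atBot atBot :=
        tendsto_neg_atTop_atBot.comp (hlen.const_mul_atTop hmem.1)
      have l2 : Tendsto (fun a : ℝ => (1 - θ) * (b - a)) atBot atTop :=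
        hlen.const_mul_atTop hθ1
      refine ((tendsto_truncKernel n 0).comp (l1.prodMk l2)).congr fun a => ?_
      have := truncKernel_add_add a b n 0 0 (a + (b - a) * θ)
      rw [zero_add] at this
      rw [this, Function.comp]
      congr 1 <;> ring
  rw [intervalIntegral.integral_const, sub_zero, one_smul] at key
  refine key.congr' ?_
  filter_upwards [eventually_lt_atBot b] with a ha
  have hne : b - a ≠ 0 := (sub_pos.2 ha).ne'
  have := intervalIntegral.smul_integral_comp_add_mul (a := 0) (b := 1)
    (fun x => truncKernel a b n x x) (b - a) a
  rw [mul_zero, mul_one, add_zero, add_sub_cancel] at this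
  rw [← this, Complex.real_smul, ← mul_assoc, inv_mul_cancel₀ (by exact_mod_cast hne), one_mul]

/-! ### Integrals of rank one operators: positivity, trace and norm. -/

section WeakIntegral

variable {H : Type*} [NormedAddCommGroup H] [InnerProductSpace ℂ H]

/-- `T` is the weak integral over `[a, b]` of the rank one operators `⟨v x, ·⟩ v x`. -/
def IsRankOneIntegral (T : H →L[ℂ] H) (v : ℝ → H) (a b : ℝ) : Prop :=
  ∀ f g : H, ⟪f, T g⟫_ℂ = ∫ x in a..b, ⟪f, v x⟫_ℂ * ⟪v x, g⟫_ℂ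

/-- Distinct orthonormal vectors lie at distance `√2`. Countability is needed to exchange the sum
over a basis with the integral. -/
theorem countable_of_orthonormal [TopologicalSpace.SeparableSpace H] {ι : Type*} {e : ι → H}
    (he : Orthonormal ℂ e) : Countable ι := by
  refine Pairwise.countable_of_isOpen_disjoint (s := fun i => Metric.ball (e i) (1 / 2))
    (fun i j hij => Metric.ball_disjoint_ball ?_) (fun _ => Metric.isOpen_ball)
    fun i => ⟨e i, Metric.mem_ball_self (by norm_num)⟩
  have h1 : ‖e i - e j‖ ^ 2 = 2 := by
    rw [@norm_sub_sq ℂ, he.1, he.1, he.2 hij]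
    norm_num
  rw [dist_eq_norm]
  nlinarith [norm_nonneg (e i - e j)]

variable {T : H →L[ℂ] H} {v : ℝ → H} {a b : ℝ}

theorem conj_inner_mul_inner (x y : H) : ⟪x, y⟫_ℂ * ⟪y, x⟫_ℂ = ((‖⟪y, x⟫_ℂ‖ ^ 2 : ℝ) : ℂ) := by
  rw [← inner_conj_symm x y, mul_comm, Complex.mul_conj, Complex.normSq_eq_norm_sq]

theorem IsRankOneIntegral.inner_self (hT : IsRankOneIntegral T v a b) (f : H) :
    ⟪f, T f⟫_ℂ = ((∫ x in a..b, ‖⟪v x, f⟫_ℂ‖ ^ 2 : ℝ) : ℂ) := by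
  rw [hT, ← intervalIntegral.integral_ofReal]
  simp_rw [conj_inner_mul_inner]

theorem IsRankOneIntegral.nonneg (hT : IsRankOneIntegral T v a b) (hab : a ≤ b) : 0 ≤ T := by
  rw [ContinuousLinearMap.nonneg_iff_isPositive, ContinuousLinearMap.isPositive_iff_complex]
  intro f
  have h0 : 0 ≤ ∫ x in a..b, ‖⟪v x, f⟫_ℂ‖ ^ 2 :=
    intervalIntegral.integral_nonneg hab fun _ _ => by positivity
  have h : ⟪T f, f⟫_ℂ = ((∫ x in a..b, ‖⟪v x, f⟫_ℂ‖ ^ 2 : ℝ) : ℂ) := by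
    rw [← inner_conj_symm, hT.inner_self, Complex.conj_ofReal]
  rw [h]
  exact ⟨by simp, by simpa using h0⟩

/-- Each factor of `T` contributes one integration. The index matches exactly because `truncKernel a
b 0` is `k` itself, the Gram kernel, and not the identity. -/
theorem IsRankOneIntegral.inner_pow (hT : IsRankOneIntegral T v a b)
    (hk : ∀ x y, ⟪v x, v y⟫_ℂ = sechKernel (x - y)) (n : ℕ) (x y : ℝ) :
    ⟪v x, (T ^ n) (v y)⟫_ℂ = truncKernel a b n x y := by
  induction n generalizing x with
  | zero => simpa [truncKernel] using hk x y
  | succ n ih =>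
    rw [pow_succ', mul_apply_eq_comp, hT, truncKernel_succ]
    simp_rw [ih, hk]

theorem inner_self_eq_ofReal_norm_sq (x : H) : ⟪x, x⟫_ℂ = ((‖x‖ ^ 2 : ℝ) : ℂ) := by
  rw [inner_self_eq_norm_sq_to_K]
  simp

theorem norm_sq_eq_half (hk : ∀ x y, ⟪v x, v y⟫_ℂ = sechKernel (x - y)) (x : ℝ) :
    ‖v x‖ ^ 2 = 1 / 2 := by
  have h := hk x x
  rw [sub_self, sechKernel_zero, inner_self_eq_ofReal_norm_sq] at h
  exact Complex.ofReal_injective h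

theorem continuous_of_inner_eq_sechKernel (hk : ∀ x y, ⟪v x, v y⟫_ℂ = sechKernel (x - y)) :
    Continuous v := by
  refine continuous_iff_continuousAt.2 fun x => ?_
  rw [ContinuousAt, tendsto_iff_norm_sub_tendsto_zero]
  have h : ∀ y, ‖v y - v x‖ = √(1 - 2 * sechKernel (y - x)) := fun y => by
    rw [← Real.sqrt_sq (norm_nonneg (v y - v x)), @norm_sub_sq ℂ, hk, norm_sq_eq_half hk,
      norm_sq_eq_half hk]
    congr 1
    simp only [RCLike.re_to_complex, Complex.ofReal_re]
    ring
  simp_rw [h]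
  have hc : Continuous fun y => √(1 - 2 * sechKernel (y - x)) :=
    ((continuous_const.sub (continuous_const.mul
      (continuous_sechKernel.comp (continuous_sub_right x))))).sqrt
  have := hc.tendsto x
  simpa [sechKernel_zero] using this

theorem norm_integral_inner_le (hk : ∀ x y, ⟪v x, v y⟫_ℂ = sechKernel (x - y)) (hab : a ≤ b)
    (A : H →L[ℂ] H) : ‖∫ x in a..b, ⟪v x, A (v x)⟫_ℂ‖ ≤ ‖A‖ / 2 * (b - a) := by
  have := intervalIntegral.norm_integral_le_of_norm_le_const (a := a) (b := b) (C := ‖A‖ / 2)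
    (f := fun x => ⟪v x, A (v x)⟫_ℂ) fun x _ => by
      refine (norm_inner_le_norm _ _).trans ?_
      have h1 := A.le_opNorm (v x)
      have h2 := norm_sq_eq_half hk x
      calc ‖v x‖ * ‖A (v x)‖ ≤ ‖v x‖ * (‖A‖ * ‖v x‖) := by gcongr
        _ = ‖A‖ * ‖v x‖ ^ 2 := by ring
        _ = ‖A‖ / 2 := by rw [h2]; ring
  rwa [abs_of_nonneg (sub_nonneg.2 hab)] at this

variable [CompleteSpace H]

/-- Expand `T` as its integral and exchange: Bessel's inequality bounds the partial sums by `‖S (v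
x)‖ ^ 2`, and Parseval then evaluates the sum under the integral. -/
theorem IsRankOneIntegral.hasSum_inner [TopologicalSpace.SeparableSpace H]
    (hT : IsRankOneIntegral T v a b) (hv : Continuous v) (hab : a ≤ b) {S : H →L[ℂ] H}
    (hS : IsSelfAdjoint S) {ι : Type*} (e : HilbertBasis ι ℂ H) :
    HasSum (fun i => ⟪e i, (S * T * S) (e i)⟫_ℂ) (∫ x in a..b, ⟪v x, (S * S) (v x)⟫_ℂ) := by
  have : Countable ι := countable_of_orthonormal e.orthonormal
  have hsymm : ∀ x y : H, ⟪S x, y⟫_ℂ = ⟪x, S y⟫_ℂ :=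
    (ContinuousLinearMap.isSelfAdjoint_iff_isSymmetric.1 hS)
  set F : ι → ℝ → ℂ := fun i x => ⟪S (v x), e i⟫_ℂ * ⟪e i, S (v x)⟫_ℂ with hF
  have hcont : ∀ i, Continuous (F i) := fun i => by
    have : Continuous fun x => S (v x) := S.continuous.comp hv
    exact (this.inner continuous_const).mul (continuous_const.inner this)
  have hint : ∀ i, Integrable (F i) (volume.restrict (Ioc a b)) := fun i =>
    ((hcont i).intervalIntegrable a b).1
  have hnorm : ∀ i x, ‖F i x‖ = ‖⟪e i, S (v x)⟫_ℂ‖ ^ 2 := fun i x => by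
    simp only [hF]
    rw [conj_inner_mul_inner, Complex.norm_real, Real.norm_of_nonneg (by positivity)]
  have hsum : Summable fun i => ∫ x in Ioc a b, ‖F i x‖ := by
    refine summable_of_sum_le (c := ∫ x in Ioc a b, ‖S (v x)‖ ^ 2)
      (fun i => integral_nonneg fun x => norm_nonneg _) fun s => ?_
    rw [← integral_finsetSum _ fun i _ => (hint i).norm]
    refine integral_mono (integrable_finsetSum _ fun i _ => (hint i).norm) ?_ fun x => ?_
    · exact (((S.continuous.comp hv).norm.pow 2).intervalIntegrable a b).1
    · simp only [hnorm]
      exact Orthonormal.sum_inner_products_le _ e.orthonormal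
  have h := hasSum_integral_of_summable_integral_norm hint hsum
  have h1 : ∀ i, ∫ x in Ioc a b, F i x = ⟪e i, (S * T * S) (e i)⟫_ℂ := fun i => by
    change _ = ⟪e i, S (T (S (e i)))⟫_ℂ
    rw [← hsymm, hT, intervalIntegral.integral_of_le hab]
    refine integral_congr_ae (Eventually.of_forall fun x => ?_)
    simp only [hF, hsymm]
    ring
  have h2 : ∀ x, ∑' i, F i x = ⟪v x, (S * S) (v x)⟫_ℂ := fun x => by
    rw [(e.hasSum_inner_mul_inner (S (v x)) (S (v x))).tsum_eq, hsymm]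
    rfl
  simp_rw [h1, h2] at h
  rwa [intervalIntegral.integral_of_le hab]

theorem continuousOn_rpow_of_nonneg {r : ℝ} (hr : 0 ≤ r) (s : Set ℝ) :
    ContinuousOn (fun t : ℝ => t ^ r) s :=
  (Real.continuous_rpow_const hr).continuousOn

theorem operatorPower_eq_conj (hT : 0 ≤ T) {q : ℝ} (hq : 1 ≤ q) :
    operatorPower T q =
      cfc (fun t : ℝ => t ^ ((q - 1) / 2)) T * T * cfc (fun t : ℝ => t ^ ((q - 1) / 2)) T := by
  have hr : 0 ≤ (q - 1) / 2 := by linarith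
  have hsa : IsSelfAdjoint T := IsSelfAdjoint.of_nonneg hT
  have hc := continuousOn_rpow_of_nonneg hr (spectrum ℝ T)
  rw [operatorPower, CFC.rpow_eq_cfc_real hT]
  have hmul : cfc (fun t : ℝ => t ^ ((q - 1) / 2) * t * t ^ ((q - 1) / 2)) T =
      cfc (fun t : ℝ => t ^ ((q - 1) / 2)) T * T * cfc (fun t : ℝ => t ^ ((q - 1) / 2)) T := by
    rw [cfc_mul _ _ T, cfc_mul _ _ T, cfc_id' ℝ T]
  rw [← hmul]
  refine cfc_congr fun t ht => ?_
  have ht0 : 0 ≤ t := spectrum_nonneg_of_nonneg hT ht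
  change t ^ q = t ^ ((q - 1) / 2) * t * t ^ ((q - 1) / 2)
  -- At `t = 0` and `q = 1` the outer factors are `0 ^ 0 = 1`; the middle factor `t` makes both
  -- sides vanish.
  rcases ht0.eq_or_lt with h | h
  · rw [← h, Real.zero_rpow (by linarith)]; simp
  · nth_rw 3 [← Real.rpow_one t]
    rw [← Real.rpow_add h, ← Real.rpow_add h]
    congr 1; ring

theorem cfc_rpow_half_mul_self (hT : 0 ≤ T) {q : ℝ} (hq : 1 ≤ q) :
    cfc (fun t : ℝ => t ^ ((q - 1) / 2)) T * cfc (fun t : ℝ => t ^ ((q - 1) / 2)) T =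
      cfc (fun t : ℝ => t ^ (q - 1)) T := by
  have hr : 0 ≤ (q - 1) / 2 := by linarith
  have hsa : IsSelfAdjoint T := IsSelfAdjoint.of_nonneg hT
  have hc := continuousOn_rpow_of_nonneg hr (spectrum ℝ T)
  rw [← cfc_mul _ _ T]
  refine cfc_congr fun t ht => ?_
  have ht0 : 0 ≤ t := spectrum_nonneg_of_nonneg hT ht
  rw [← Real.rpow_add_of_nonneg ht0 hr hr]
  congr 1; ring

theorem IsRankOneIntegral.hasSum_inner_operatorPower [TopologicalSpace.SeparableSpace H]
    (hT : IsRankOneIntegral T v a b) (hv : Continuous v) (hab : a ≤ b) {q : ℝ} (hq : 1 ≤ q)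
    {ι : Type*} (e : HilbertBasis ι ℂ H) :
    HasSum (fun i => ⟪e i, operatorPower T q (e i)⟫_ℂ)
      (∫ x in a..b, ⟪v x, cfc (fun t : ℝ => t ^ (q - 1)) T (v x)⟫_ℂ) := by
  have h0 := hT.nonneg hab
  rw [operatorPower_eq_conj h0 hq, ← cfc_rpow_half_mul_self h0 hq]
  exact hT.hasSum_inner hv hab (cfc_predicate _ T) e

theorem IsRankOneIntegral.isTraceClass_operatorPower [TopologicalSpace.SeparableSpace H]
    (hT : IsRankOneIntegral T v a b) (hv : Continuous v) (hab : a ≤ b) {q : ℝ} (hq : 1 ≤ q) :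
    IsTraceClass (operatorPower T q) := by
  intro w e
  rw [CFC.abs_of_nonneg _ (show 0 ≤ operatorPower T q from CFC.rpow_nonneg)]
  exact (Complex.hasSum_re (hT.hasSum_inner_operatorPower hv hab hq e)).summable

theorem IsRankOneIntegral.isTraceClass [TopologicalSpace.SeparableSpace H]
    (hT : IsRankOneIntegral T v a b) (hv : Continuous v) (hab : a ≤ b) : IsTraceClass T := by
  have h := hT.isTraceClass_operatorPower hv hab le_rfl
  rwa [operatorPower, CFC.rpow_one T (hT.nonneg hab)] at h

theorem IsRankOneIntegral.operatorTrace_operatorPower [TopologicalSpace.SeparableSpace H]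
    (hT : IsRankOneIntegral T v a b) (hv : Continuous v) (hab : a ≤ b) {q : ℝ} (hq : 1 ≤ q) :
    operatorTrace (operatorPower T q) =
      ∫ x in a..b, ⟪v x, cfc (fun t : ℝ => t ^ (q - 1)) T (v x)⟫_ℂ :=
  (hT.hasSum_inner_operatorPower hv hab hq _).tsum_eq

/-- By self-adjointness the left side is `⟪v x, T ^ (2 n) v x⟫`, a diagonal value of an iterated
kernel. -/
theorem IsRankOneIntegral.norm_pow_apply_le (hT : IsRankOneIntegral T v a b) (hab : a ≤ b)
    (hk : ∀ x y, ⟪v x, v y⟫_ℂ = sechKernel (x - y)) (n : ℕ) (x : ℝ) :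
    ‖(T ^ n) (v x)‖ ^ 2 ≤ Real.pi ^ (2 * n) / 2 := by
  have hsa : IsSelfAdjoint (T ^ n) := (IsSelfAdjoint.of_nonneg (hT.nonneg hab)).pow n
  have hsymm := ContinuousLinearMap.isSelfAdjoint_iff_isSymmetric.1 hsa
  have h1 : ((‖(T ^ n) (v x)‖ ^ 2 : ℝ) : ℂ) = truncKernel a b (2 * n) x x := by
    rw [← hT.inner_pow hk, two_mul, pow_add, mul_apply_eq_comp]
    rw [← inner_self_eq_ofReal_norm_sq]
    exact hsymm _ _
  have h2 := norm_truncKernel_le hab (2 * n) x x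
  rwa [← h1, Complex.norm_real, Real.norm_of_nonneg (by positivity)] at h2

/-- Expand one factor of `T` as its integral and move `T ^ n` onto `v x`. The crude factor `b - a`
is harmless once roots of high order are taken. -/
theorem IsRankOneIntegral.norm_pow_succ_le (hT : IsRankOneIntegral T v a b) (hab : a ≤ b)
    (hk : ∀ x y, ⟪v x, v y⟫_ℂ = sechKernel (x - y)) (n : ℕ) :
    ‖T ^ (n + 1)‖ ≤ Real.pi ^ n * (b - a) := by
  have hp : 0 < Real.pi ^ n := pow_pos Real.pi_pos n
  have hC : 0 ≤ Real.pi ^ n * (b - a) := mul_nonneg hp.le (sub_nonneg.2 hab)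
  refine ContinuousLinearMap.opNorm_le_bound _ hC fun g => ?_
  have hsa : IsSelfAdjoint (T ^ n) := (IsSelfAdjoint.of_nonneg (hT.nonneg hab)).pow n
  have hsymm := ContinuousLinearMap.isSelfAdjoint_iff_isSymmetric.1 hsa
  have key : ∀ f : H, ‖⟪f, (T ^ (n + 1)) g⟫_ℂ‖ ≤ Real.pi ^ n * (b - a) * ‖g‖ * ‖f‖ := fun f => by
    rw [pow_succ', mul_apply_eq_comp, hT]
    have := intervalIntegral.norm_integral_le_of_norm_le_const (a := a) (b := b)
      (C := Real.pi ^ n * ‖g‖ * ‖f‖)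
      (f := fun x => ⟪f, v x⟫_ℂ * ⟪v x, (T ^ n) g⟫_ℂ) fun x _ => by
        have h1 : ‖v x‖ ≤ 1 := by nlinarith [norm_sq_eq_half hk x, norm_nonneg (v x)]
        have h2 : ‖(T ^ n) (v x)‖ ≤ Real.pi ^ n := by
          refine (sq_le_sq₀ (norm_nonneg _) hp.le).1 ?_
          have := hT.norm_pow_apply_le hab hk n x
          rw [← pow_mul, mul_comm n 2]
          have : 0 < Real.pi ^ (2 * n) := pow_pos Real.pi_pos _
          linarith
        have h3 : ⟪v x, (T ^ n) g⟫_ℂ = ⟪(T ^ n) (v x), g⟫_ℂ := (hsymm _ _).symm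
        rw [norm_mul, h3]
        calc ‖⟪f, v x⟫_ℂ‖ * ‖⟪(T ^ n) (v x), g⟫_ℂ‖
            ≤ (‖f‖ * 1) * (Real.pi ^ n * ‖g‖) := by
              gcongr
              · exact (norm_inner_le_norm _ _).trans (by gcongr)
              · exact (norm_inner_le_norm _ _).trans (by gcongr)
          _ = Real.pi ^ n * ‖g‖ * ‖f‖ := by ring
    rw [abs_of_nonneg (sub_nonneg.2 hab)] at this
    exact this.trans_eq (by ring)
  have h := key ((T ^ (n + 1)) g)
  rw [inner_self_eq_ofReal_norm_sq, Complex.norm_real, Real.norm_of_nonneg (by positivity)] at h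
  rcases (norm_nonneg ((T ^ (n + 1)) g)).eq_or_lt with h0 | h0
  · rw [← h0]; positivity
  · nlinarith

theorem IsRankOneIntegral.norm_le_pi (hT : IsRankOneIntegral T v a b) (hab : a ≤ b)
    (hk : ∀ x y, ⟪v x, v y⟫_ℂ = sechKernel (x - y)) : ‖T‖ ≤ Real.pi := by
  by_contra! hlt
  have hsa : IsSelfAdjoint T := IsSelfAdjoint.of_nonneg (hT.nonneg hab)
  have hpi := Real.pi_pos
  -- For self-adjoint `T` the norm of `T ^ 2 ^ n` is `‖T‖ ^ 2 ^ n`, so the powers of `‖T‖ / π` with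
  -- exponent `2 ^ n` stay below `(b - a) / π`; a ratio above `1` contradicts this.
  obtain ⟨n, hn⟩ := pow_unbounded_of_one_lt ((b - a) / Real.pi) ((one_lt_div hpi).2 hlt)
  have h1 : ‖T‖ ^ 2 ^ n ≤ Real.pi ^ (2 ^ n - 1) * (b - a) := by
    rw [← hsa.norm_pow_two_pow n]
    have h2 := hT.norm_pow_succ_le hab hk (2 ^ n - 1)
    rwa [Nat.sub_add_cancel Nat.one_le_two_pow] at h2
  have h2 : (‖T‖ / Real.pi) ^ n ≤ (‖T‖ / Real.pi) ^ 2 ^ n :=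
    pow_le_pow_right₀ ((one_lt_div hpi).2 hlt).le Nat.lt_two_pow_self.le
  have h3 : (‖T‖ / Real.pi) ^ 2 ^ n ≤ (b - a) / Real.pi := by
    rw [div_pow, div_le_div_iff₀ (by positivity) hpi]
    have h4 : Real.pi ^ 2 ^ n = Real.pi ^ (2 ^ n - 1) * Real.pi := by
      rw [← pow_succ, Nat.sub_add_cancel Nat.one_le_two_pow]
    rw [h4]
    nlinarith
  linarith

end WeakIntegral

/-! ### The Hankel operator as an integral of rank one operators. -/

/-- The exponential `exp (-λ t)`, for `λ = exp x`, times `λ ^ (1 / 2)`. -/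
noncomputable def scaledExp (x t : ℝ) : ℝ := Real.exp (x / 2) * Real.exp (-Real.exp x * t)

theorem memLp_scaledExp (x : ℝ) : MemLp (fun t => (scaledExp x t : ℂ)) 2 halfLine :=
  ((memLp_exp_halfLine (Real.exp_pos x)).const_mul (Real.exp (x / 2))).ofReal

/-- The function `scaledExp x` as a vector of `L²(ℝ₊)`. -/
noncomputable def expVec (x : ℝ) : HalfLineL2 := (memLp_scaledExp x).toLp

theorem inner_expVec_left (x : ℝ) (f : HalfLineL2) :
    ⟪expVec x, f⟫_ℂ = ∫ s, (scaledExp x s : ℂ) * f s ∂halfLine := by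
  rw [L2.inner_def]
  refine integral_congr_ae ?_
  filter_upwards [(memLp_scaledExp x).coeFn_toLp] with s hs
  rw [expVec, hs, RCLike.inner_apply, Complex.conj_ofReal, mul_comm]

theorem inner_expVec_expVec (x y : ℝ) : ⟪expVec x, expVec y⟫_ℂ = sechKernel (x - y) := by
  have hx := Real.exp_pos x
  have hy := Real.exp_pos y
  have h1 : ⟪expVec x, expVec y⟫_ℂ = ∫ s in Ioi (0 : ℝ), ((Real.exp (x / 2) * Real.exp (y / 2) *
      Real.exp (-(Real.exp x + Real.exp y) * s) : ℝ) : ℂ) := by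
    rw [inner_expVec_left]
    refine integral_congr_ae ?_
    filter_upwards [(memLp_scaledExp y).coeFn_toLp] with s hs
    rw [expVec, hs, ← Complex.ofReal_mul, neg_add, add_mul, Real.exp_add, scaledExp, scaledExp]
    congr 1
    ring
  rw [h1, integral_complex_ofReal, integral_const_mul, integral_exp_mul_Ioi (by linarith)]
  congr 1
  have e1 : Real.exp x = Real.exp (x / 2) * Real.exp (x / 2) := by rw [← Real.exp_add]; ring_nf
  have e2 : Real.exp y = Real.exp (y / 2) * Real.exp (y / 2) := by rw [← Real.exp_add]; ring_nf
  have p1 := Real.exp_pos (x / 2)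
  have p2 := Real.exp_pos (y / 2)
  rw [sechKernel, Real.cosh_eq, sub_div, neg_sub, Real.exp_sub, Real.exp_sub, mul_zero,
    Real.exp_zero, e1, e2]
  field_simp

theorem continuous_expVec : Continuous expVec :=
  continuous_of_inner_eq_sechKernel inner_expVec_expVec

theorem scaledExp_mul_scaledExp (x s t : ℝ) :
    scaledExp x s * scaledExp x t = Real.exp x * Real.exp (-Real.exp x * (s + t)) := by
  rw [scaledExp, scaledExp, mul_add, Real.exp_add,
    show Real.exp x = Real.exp (x / 2) * Real.exp (x / 2) by rw [← Real.exp_add]; ring_nf]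
  ring

theorem continuous_scaledExp : Continuous fun p : ℝ × ℝ => scaledExp p.1 p.2 := by
  unfold scaledExp; fun_prop

theorem gammaKernel_add_eq_integral {ε δ s t : ℝ} (hε : 0 < ε) (hδ : 0 < δ) (h : 0 < s + t) :
    gammaKernel ε δ (s + t) =
      ∫ x in Real.log ε..Real.log δ, scaledExp x s * scaledExp x t := by
  have hd : ∀ x ∈ uIcc (Real.log ε) (Real.log δ),
      HasDerivAt (fun x => -(Real.exp (-(s + t) * Real.exp x) / (s + t)))
        (scaledExp x s * scaledExp x t) x := fun x _ => by
    have h1 := ((((Real.hasDerivAt_exp x).const_mul (-(s + t))).exp).div_const (s + t)).neg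
    refine h1.congr_deriv ?_
    rw [scaledExp_mul_scaledExp, show -Real.exp x * (s + t) = -(s + t) * Real.exp x by ring]
    field_simp
  rw [intervalIntegral.integral_eq_sub_of_hasDerivAt hd]
  · rw [Real.exp_log hε, Real.exp_log hδ, gammaKernel]
    ring
  · refine Continuous.intervalIntegrable ?_ _ _
    unfold scaledExp; fun_prop

theorem scaledExp_nonneg (x t : ℝ) : 0 ≤ scaledExp x t := by unfold scaledExp; positivity

theorem scaledExp_le {ε B x s : ℝ} (hε : 0 < ε) (hx : x ∈ Icc (Real.log ε) B) (hs : 0 ≤ s) :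
    scaledExp x s ≤ Real.exp (B / 2) * Real.exp (-ε * s) := by
  have h1 : ε ≤ Real.exp x := (Real.log_le_iff_le_exp hε).1 hx.1
  have h2 : x ≤ B := hx.2
  unfold scaledExp
  gcongr

/-- Fubini, in a form used twice: once for the values of `Γ_ε g`, once for its inner products. The
decay `exp (-ε s)` of the exponentials, uniform over the interval, gives the majorant. -/
theorem integral_integral_scaledExp_swap {ε B : ℝ} (hε : 0 < ε) (hB : Real.log ε ≤ B)
    {f : ℝ → ℂ} (hf : AEStronglyMeasurable f halfLine)
    (hint : Integrable (fun s => Real.exp (-ε * s) * ‖f s‖) halfLine) {G : ℝ → ℂ}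
    (hG : Continuous G) :
    ∫ s, (∫ x in Real.log ε..B, (scaledExp x s : ℂ) * G x) * f s ∂halfLine =
      ∫ x in Real.log ε..B, G x * ∫ s, (scaledExp x s : ℂ) * f s ∂halfLine := by
  have h1 : ∀ x, G x * ∫ s, (scaledExp x s : ℂ) * f s ∂halfLine =
      ∫ s, (scaledExp x s : ℂ) * G x * f s ∂halfLine := fun x => by
    rw [← integral_const_mul]
    congr 1; ext s; ring
  simp_rw [h1, ← intervalIntegral.integral_mul_const]
  rw [intervalIntegral_integral_swap]
  rw [uIoc_of_le hB]
  obtain ⟨C, hC⟩ := isCompact_Icc.exists_bound_of_continuousOn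
    (hG.continuousOn (s := Icc (Real.log ε) B))
  have h2 : Integrable (fun p : ℝ × ℝ => (Real.exp (B / 2) * C) *
      (Real.exp (-ε * p.2) * ‖f p.2‖))
      ((volume.restrict (Ioc (Real.log ε) B)).prod halfLine) :=
    (integrable_const (Real.exp (B / 2) * C)).mul_prod hint
  refine h2.mono' ?_ ?_
  · refine AEStronglyMeasurable.mul ?_ hf.comp_snd
    refine Continuous.aestronglyMeasurable ?_
    exact (Complex.continuous_ofReal.comp continuous_scaledExp).mul (hG.comp continuous_fst)
  · have h3 : ∀ᵐ p : ℝ × ℝ ∂((volume.restrict (Ioc (Real.log ε) B)).prod halfLine),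
        p ∈ Ioc (Real.log ε) B ×ˢ Ioi (0 : ℝ) := by
      rw [Measure.prod_restrict]
      exact ae_restrict_mem (measurableSet_Ioc.prod measurableSet_Ioi)
    filter_upwards [h3] with p hp
    have hp1 : p.1 ∈ Icc (Real.log ε) B := Ioc_subset_Icc_self hp.1
    have b1 := scaledExp_le hε hp1 (le_of_lt hp.2)
    have b2 := hC p.1 hp1
    rw [Function.uncurry, norm_mul, norm_mul, Complex.norm_real,
      Real.norm_of_nonneg (scaledExp_nonneg _ _)]
    calc scaledExp p.1 p.2 * ‖G p.1‖ * ‖f p.2‖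
        ≤ (Real.exp (B / 2) * Real.exp (-ε * p.2)) * C * ‖f p.2‖ := by
          gcongr
      _ = _ := by ring

theorem Gamma_apply_ae_eq_integral {ε δ : ℝ} (hε : 0 < ε) (h : ε ≤ δ) (g : HalfLineL2) :
    Gamma ε δ g =ᵐ[halfLine] fun t =>
      ∫ x in Real.log ε..Real.log δ, (scaledExp x t : ℂ) * ⟪expVec x, g⟫_ℂ := by
  have hlog : Real.log ε ≤ Real.log δ := Real.log_le_log hε h
  filter_upwards [Gamma_apply_ae hε h g, ae_restrict_mem measurableSet_Ioi] with t ht ht0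
  rw [ht]
  simp_rw [inner_expVec_left]
  rw [← integral_integral_scaledExp_swap hε hlog (Lp.aestronglyMeasurable g)
    (integrable_exp_mul_norm hε g) (G := fun x => (scaledExp x t : ℂ))
    (Complex.continuous_ofReal.comp (continuous_scaledExp.comp
      (f := fun x : ℝ => (x, t)) (by fun_prop)))]
  refine integral_congr_ae ?_
  filter_upwards [ae_restrict_mem measurableSet_Ioi] with s hs
  rw [gammaKernel_add_eq_integral hε (hε.trans_le h) (add_pos hs ht0),
    ← intervalIntegral.integral_ofReal]
  simp_rw [Complex.ofReal_mul]

theorem isRankOneIntegral_Gamma {ε δ : ℝ} (hε : 0 < ε) (h : ε ≤ δ) :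
    IsRankOneIntegral (Gamma ε δ) expVec (Real.log ε) (Real.log δ) := by
  intro f g
  have hlog : Real.log ε ≤ Real.log δ := Real.log_le_log hε h
  have hstar : AEStronglyMeasurable (fun s => (starRingEnd ℂ) (f s)) halfLine :=
    Complex.continuous_conj.comp_aestronglyMeasurable (Lp.aestronglyMeasurable f)
  have hint : Integrable (fun s => Real.exp (-ε * s) * ‖(starRingEnd ℂ) (f s)‖) halfLine := by
    simpa using integrable_exp_mul_norm hε f
  have h1 := integral_integral_scaledExp_swap hε hlog hstar hint
    (G := fun x => ⟪expVec x, g⟫_ℂ) (continuous_expVec.inner continuous_const)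
  have h2 : ∀ x, ∫ s, (scaledExp x s : ℂ) * (starRingEnd ℂ) (f s) ∂halfLine =
      ⟪f, expVec x⟫_ℂ := fun x => by
    rw [← inner_conj_symm, inner_expVec_left, ← integral_conj]
    simp
  simp_rw [h2] at h1
  rw [L2.inner_def]
  refine Eq.trans ?_ (h1.trans ?_)
  · refine integral_congr_ae ?_
    filter_upwards [Gamma_apply_ae_eq_integral hε h g] with t ht
    rw [RCLike.inner_apply, ht]
  · simp_rw [mul_comm]

theorem separableSpace_halfLineL2 : TopologicalSpace.SeparableSpace HalfLineL2 := by
  have : Fact ((2 : ℝ≥0∞) ≠ ∞) := ⟨by norm_num⟩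
  infer_instance

/-! ### Averages over the symbol and the Szegő type limit. -/

theorem continuous_comp_sechSymbol {g : ℝ → ℝ} (hg : ContinuousOn g (Icc 0 Real.pi)) :
    Continuous fun ξ => g (sechSymbol ξ) :=
  hg.comp_continuous continuous_sechSymbol fun ξ => ⟨(sechSymbol_pos ξ).le, sechSymbol_le ξ⟩

theorem integrable_sechSymbol_mul_comp {g : ℝ → ℝ} (hg : ContinuousOn g (Icc 0 Real.pi)) :
    Integrable fun ξ => sechSymbol ξ * g (sechSymbol ξ) := by
  obtain ⟨C, hC⟩ := isCompact_Icc.exists_bound_of_continuousOn hg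
  refine (integrable_sechSymbol.mul_const C).mono'
    (continuous_sechSymbol.mul (continuous_comp_sechSymbol hg)).aestronglyMeasurable
    (Eventually.of_forall fun ξ => ?_)
  rw [norm_mul, Real.norm_of_nonneg (sechSymbol_pos ξ).le]
  exact mul_le_mul_of_nonneg_left (hC _ ⟨(sechSymbol_pos ξ).le, sechSymbol_le ξ⟩)
    (sechSymbol_pos ξ).le

theorem integral_sechSymbol : ∫ ξ, sechSymbol ξ = Real.pi := by
  have h := integral_sechSymbol_mul_exp 0
  simp only [Complex.ofReal_zero, zero_mul, Complex.exp_zero, mul_one, sechKernel_zero] at h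
  rw [integral_complex_ofReal] at h
  have h' : 1 / (2 * Real.pi) * ∫ ξ, sechSymbol ξ = 1 / 2 := by exact_mod_cast h
  have := Real.pi_pos
  field_simp at h'
  linarith

/-- The mean `(2π)⁻¹ ∫ σ g(σ)` against the symbol `σ = sechSymbol`. -/
noncomputable def symbolMean (g : ℝ → ℝ) : ℝ :=
  1 / (2 * Real.pi) * ∫ ξ, sechSymbol ξ * g (sechSymbol ξ)

theorem symbolMean_pow (n : ℕ) : (symbolMean (fun t => t ^ n) : ℂ) = convKernel n 0 := by
  rw [symbolMean, convKernel]
  simp only [Complex.ofReal_zero, zero_mul, Complex.exp_zero, mul_one, ← Complex.ofReal_pow]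
  rw [integral_complex_ofReal]
  push_cast
  simp_rw [pow_succ']

/-- The weight `(2π)⁻¹ σ` has total mass `1 / 2`, the same constant as `‖v x‖ ^ 2` on the operator
side. -/
theorem abs_symbolMean_sub_le {f g : ℝ → ℝ} (hf : ContinuousOn f (Icc 0 Real.pi))
    (hg : ContinuousOn g (Icc 0 Real.pi)) {η : ℝ}
    (h : ∀ t ∈ Icc 0 Real.pi, |f t - g t| ≤ η) : |symbolMean f - symbolMean g| ≤ η / 2 := by
  have hpi := Real.pi_pos
  have h1 : |∫ ξ, (sechSymbol ξ * f (sechSymbol ξ) - sechSymbol ξ * g (sechSymbol ξ))| ≤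
      ∫ ξ, sechSymbol ξ * η := by
    rw [← Real.norm_eq_abs]
    refine norm_integral_le_of_norm_le (integrable_sechSymbol.mul_const η)
      (Eventually.of_forall fun ξ => ?_)
    rw [← mul_sub, norm_mul, Real.norm_of_nonneg (sechSymbol_pos ξ).le, Real.norm_eq_abs]
    exact mul_le_mul_of_nonneg_left (h _ ⟨(sechSymbol_pos ξ).le, sechSymbol_le ξ⟩)
      (sechSymbol_pos ξ).le
  rw [integral_mul_const, integral_sechSymbol] at h1
  rw [symbolMean, symbolMean, ← mul_sub, ← integral_sub (integrable_sechSymbol_mul_comp hf)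
    (integrable_sechSymbol_mul_comp hg), abs_mul, abs_of_pos (by positivity)]
  calc _ ≤ 1 / (2 * Real.pi) * (Real.pi * η) := by gcongr
    _ = η / 2 := by field_simp

section SechGram

variable {H : Type*} [NormedAddCommGroup H] [InnerProductSpace ℂ H]
  {T : ℝ → H →L[ℂ] H} {v : ℝ → H} {b : ℝ}

theorem tendsto_mean_inner_aeval (hT : ∀ a ≤ b, IsRankOneIntegral (T a) v a b)
    (hk : ∀ x y, ⟪v x, v y⟫_ℂ = sechKernel (x - y)) (p : Polynomial ℝ) :
    Tendsto (fun a => ((b - a : ℝ) : ℂ)⁻¹ *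
      ∫ x in a..b, ⟪v x, (Polynomial.aeval (T a) p) (v x)⟫_ℂ) atBot
      (𝓝 (symbolMean (fun t => p.eval t) : ℂ)) := by
  have hv := continuous_of_inner_eq_sechKernel hk
  induction p using Polynomial.induction_on' with
  | add p q hp hq =>
    have h1 : symbolMean (fun t => (p + q).eval t) =
        symbolMean (fun t => p.eval t) + symbolMean (fun t => q.eval t) := by
      simp only [symbolMean, Polynomial.eval_add, mul_add]
      rw [integral_add (integrable_sechSymbol_mul_comp p.continuous.continuousOn)
        (integrable_sechSymbol_mul_comp q.continuous.continuousOn), mul_add]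
    rw [h1, Complex.ofReal_add]
    refine (hp.add hq).congr fun a => ?_
    have hi : ∀ A : H →L[ℂ] H, IntervalIntegrable (fun x => ⟪v x, A (v x)⟫_ℂ) volume a b :=
      fun A => (hv.inner (A.continuous.comp hv)).intervalIntegrable a b
    rw [← mul_add, ← intervalIntegral.integral_add (hi _) (hi _)]
    simp only [map_add, add_apply, inner_add_right]
  | monomial n c =>
    have h1 : (symbolMean (fun t => (Polynomial.monomial n c).eval t) : ℂ) =
        c * convKernel n 0 := by
      rw [← symbolMean_pow, ← Complex.ofReal_mul]
      congr 1
      simp only [symbolMean, Polynomial.eval_monomial]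
      simp_rw [mul_left_comm _ c]
      rw [integral_const_mul]
      ring
    rw [h1]
    refine ((tendsto_integral_truncKernel_diag b n).const_mul (c : ℂ)).congr' ?_
    filter_upwards [eventually_le_atBot b] with a ha
    rw [mul_left_comm, ← intervalIntegral.integral_const_mul]
    congr 2
    ext x
    rw [Polynomial.aeval_monomial, ← Algebra.smul_def, smul_apply,
      ← Complex.coe_smul, inner_smul_right, (hT a ha).inner_pow hk]

variable [CompleteSpace H]

/-- A polynomial within `η / 2` of `g` on `[0, π]` changes each of the two means by at most `η / 4`,
and the polynomial case contributes less than `η / 2`. -/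
theorem tendsto_mean_inner_cfc (hT : ∀ a ≤ b, IsRankOneIntegral (T a) v a b)
    (hk : ∀ x y, ⟪v x, v y⟫_ℂ = sechKernel (x - y)) {g : ℝ → ℝ}
    (hg : ContinuousOn g (Icc 0 Real.pi)) :
    Tendsto (fun a => ((b - a : ℝ) : ℂ)⁻¹ * ∫ x in a..b, ⟪v x, cfc g (T a) (v x)⟫_ℂ) atBot
      (𝓝 (symbolMean g : ℂ)) := by
  have hv := continuous_of_inner_eq_sechKernel hk
  rw [Metric.tendsto_nhds]
  intro η hη
  obtain ⟨p, hp⟩ := exists_polynomial_near_of_continuousOn 0 Real.pi g hg (η / 2) (by positivity)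
  have h1 := Metric.tendsto_nhds.1 (tendsto_mean_inner_aeval hT hk p) (η / 2) (by positivity)
  filter_upwards [h1, eventually_lt_atBot b] with a ha hab
  have hT0 := (hT a hab.le).nonneg hab.le
  have hsa : IsSelfAdjoint (T a) := IsSelfAdjoint.of_nonneg hT0
  have hspec : spectrum ℝ (T a) ⊆ Icc 0 Real.pi := fun t ht => by
    refine ⟨spectrum_nonneg_of_nonneg hT0 ht, ?_⟩
    have h2 := spectrum.norm_le_norm_mul_of_mem ht
    -- Only an inequality, since `H` may be trivial.
    have h3 : ‖(1 : H →L[ℂ] H)‖ ≤ 1 := ContinuousLinearMap.norm_id_le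
    have h4 := (hT a hab.le).norm_le_pi hab.le hk
    calc t ≤ ‖t‖ := Real.le_norm_self t
      _ ≤ ‖T a‖ * ‖(1 : H →L[ℂ] H)‖ := h2
      _ ≤ Real.pi * 1 := by gcongr
      _ = Real.pi := mul_one _
  have hgs : ContinuousOn g (spectrum ℝ (T a)) := hg.mono hspec
  have hps : ContinuousOn (fun t => p.eval t) (spectrum ℝ (T a)) := p.continuous.continuousOn
  have hdiff : ‖cfc g (T a) - Polynomial.aeval (T a) p‖ ≤ η / 2 := by
    rw [← cfc_polynomial p (T a), ← cfc_sub g _ (T a)]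
    refine norm_cfc_le (by positivity) fun t ht => ?_
    rw [Real.norm_eq_abs, abs_sub_comm]
    exact (hp t (hspec ht)).le
  have hL : 0 < b - a := sub_pos.2 hab
  have hi : ∀ A : H →L[ℂ] H, IntervalIntegrable (fun x => ⟪v x, A (v x)⟫_ℂ) volume a b :=
    fun A => (hv.inner (A.continuous.comp hv)).intervalIntegrable a b
  have d1 : dist (((b - a : ℝ) : ℂ)⁻¹ * ∫ x in a..b, ⟪v x, cfc g (T a) (v x)⟫_ℂ)
      (((b - a : ℝ) : ℂ)⁻¹ * ∫ x in a..b, ⟪v x, (Polynomial.aeval (T a) p) (v x)⟫_ℂ) ≤ η / 4 := by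
    rw [dist_eq_norm, ← mul_sub, ← intervalIntegral.integral_sub (hi _) (hi _)]
    have h5 := norm_integral_inner_le hk hab.le (cfc g (T a) - Polynomial.aeval (T a) p)
    simp only [sub_apply, inner_sub_right] at h5
    rw [norm_mul, norm_inv, Complex.norm_real, Real.norm_of_nonneg hL.le]
    calc _ ≤ (b - a)⁻¹ * (η / 2 / 2 * (b - a)) := by
          gcongr
          exact h5.trans (by gcongr)
      _ = η / 4 := by field_simp; norm_num
  have d2 : dist (symbolMean (fun t => p.eval t) : ℂ) (symbolMean g : ℂ) ≤ η / 4 := by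
    rw [dist_eq_norm, ← Complex.ofReal_sub, Complex.norm_real, Real.norm_eq_abs]
    refine (abs_symbolMean_sub_le p.continuous.continuousOn hg
      fun t ht => (hp t ht).le).trans_eq ?_
    ring
  have := dist_triangle4 (((b - a : ℝ) : ℂ)⁻¹ * ∫ x in a..b, ⟪v x, cfc g (T a) (v x)⟫_ℂ)
    (((b - a : ℝ) : ℂ)⁻¹ * ∫ x in a..b, ⟪v x, (Polynomial.aeval (T a) p) (v x)⟫_ℂ)
    (symbolMean (fun t => p.eval t) : ℂ) (symbolMean g : ℂ)
  linarith

end SechGram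

/-! ### Normalisation by `|log ε|` and conclusion. -/

theorem symbolMean_rpow {q : ℝ} : symbolMean (fun t => t ^ (q - 1)) =
    1 / (2 * Real.pi) * ∫ x : ℝ, (Real.pi / Real.cosh (Real.pi * x)) ^ q := by
  rw [symbolMean]
  congr 1
  refine integral_congr_ae (Eventually.of_forall fun ξ => ?_)
  change sechSymbol ξ * sechSymbol ξ ^ (q - 1) = sechSymbol ξ ^ q
  rw [Real.rpow_sub_one (sechSymbol_pos ξ).ne', mul_div_cancel₀ _ (sechSymbol_pos ξ).ne']

/-- With `a = log ε` and `c = log δ`, this replaces division by the interval length with division by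
`|log ε|`. -/
theorem tendsto_log_ratio (c : ℝ) :
    Tendsto (fun a : ℝ => ((|a|⁻¹ * (c - a) : ℝ) : ℂ)) atBot (𝓝 1) := by
  have h1 : Tendsto (fun a : ℝ => 1 - c * a⁻¹) atBot (𝓝 (1 - c * 0)) :=
    tendsto_const_nhds.sub (tendsto_inv_atBot_zero.const_mul c)
  rw [mul_zero, sub_zero] at h1
  have h2 : Tendsto (fun a : ℝ => |a|⁻¹ * (c - a)) atBot (𝓝 1) := by
    refine h1.congr' ?_
    filter_upwards [eventually_lt_atBot 0] with a ha
    rw [abs_of_neg ha]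
    have := ha.ne
    field_simp
    ring
  exact (Complex.continuous_ofReal.tendsto 1).comp h2

theorem lemma2 (δ : ℝ) (hδ : 0 < δ) :
    (∀ ε : ℝ, 0 < ε → ε ≤ δ →
      IsTraceClass (Gamma ε δ) ∧ 0 ≤ Gamma ε δ ∧ ‖Gamma ε δ‖ ≤ Real.pi ∧
        ∀ q : ℝ, 1 ≤ q → IsTraceClass (operatorPower (Gamma ε δ) q)) ∧
    ∀ q : ℝ, 1 ≤ q →
      Filter.Tendsto
        (fun ε : ℝ => ((|Real.log ε|⁻¹ : ℝ) : ℂ) * operatorTrace (operatorPower (Gamma ε δ) q))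
        (nhdsWithin 0 (Set.Ioi 0))
        (nhds ((1 / (2 * Real.pi) *
          ∫ x : ℝ, (Real.pi / Real.cosh (Real.pi * x)) ^ q : ℝ) : ℂ)) := by
  have := separableSpace_halfLineL2
  refine ⟨fun ε hε h => ?_, fun q hq => ?_⟩
  · have hT := isRankOneIntegral_Gamma hε h
    have hlog : Real.log ε ≤ Real.log δ := Real.log_le_log hε h
    exact ⟨hT.isTraceClass continuous_expVec hlog, hT.nonneg hlog,
      hT.norm_le_pi hlog inner_expVec_expVec,
      fun q hq => hT.isTraceClass_operatorPower continuous_expVec hlog hq⟩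
  · have hT : ∀ a ≤ Real.log δ,
        IsRankOneIntegral (Gamma (Real.exp a) δ) expVec a (Real.log δ) := fun a ha => by
      have h := isRankOneIntegral_Gamma (Real.exp_pos a) ((Real.le_log_iff_exp_le hδ).1 ha)
      rwa [Real.log_exp] at h
    have h1 := tendsto_mean_inner_cfc hT inner_expVec_expVec
      (continuousOn_rpow_of_nonneg (sub_nonneg.2 hq) _)
    rw [symbolMean_rpow] at h1
    -- The limit `a → -∞` is pulled back along `a = log ε`.
    have h2 := ((tendsto_log_ratio (Real.log δ)).mul h1).comp Real.tendsto_log_nhdsGT_zero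
    rw [one_mul] at h2
    refine h2.congr' ?_
    filter_upwards [Ioo_mem_nhdsGT hδ] with ε hε
    have hlog : Real.log ε < Real.log δ := Real.log_lt_log hε.1 hε.2
    have hne : ((Real.log δ - Real.log ε : ℝ) : ℂ) ≠ 0 := by
      exact_mod_cast (sub_pos.2 hlog).ne'
    rw [(isRankOneIntegral_Gamma hε.1 hε.2.le).operatorTrace_operatorPower continuous_expVec
      hlog.le hq]
    simp only [Function.comp, Real.exp_log hε.1]
    rw [Complex.ofReal_mul, mul_assoc, ← mul_assoc (((Real.log δ - Real.log ε : ℝ)) : ℂ),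
      mul_inv_cancel₀ hne, one_mul]
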